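/- Let $G$ be a finite abelian group and let $A$ be a finite set with $q = |A| \ge 2$ such that $q$ does not divide $|G|$. Let $\mathrm{CA}(G;A)$ be the monoid (under composition) of all cellular automata over $G$ and $A$, i.e. of all maps $\tau : A^G \to A^G$ for which there are a finite set $S \subseteq G$ and a function $\mu : A^S \to A$ such that $\tau(x)(g) = \mu\big((x(sg))_{s \in S}\big)$ for all $x \in A^G$ and $g \in G$, and let $\mathrm{ICA}(G;A)$ be the set of those $\tau \in \mathrm{CA}(G;A)$ that have a two-sided inverse in $\mathrm{CA}(G;A)$. For a monoid $M$ and $U \subseteq M$, let $\mathrm{Rank}(M:U)$ be the least cardinality of a subset $V \subseteq M$ such that $U \cup V$ generates $M$ as a monoid. Let $\mathcal{C}_G$ be the set of conjugacy classes $[H]$ of subgroups $H \le G$, write $[H] \le [K]$ if $H \le g^{-1}Kg$ for some $g \in G$, and let $\mathcal{E}_G = \{([H],[K]) \in \mathcal{C}_G^2 : [H] \le [K]\}$ (as $G$ is abelian, $|\mathcal{E}_G|$ is the number of pairs of subgroups $H \le K$ of $G$, including the pairs with $H = K$). Then $$\mathrm{Rank}\big(\mathrm{CA}(G;A) : \mathrm{ICA}(G;A)\big)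 = |\mathcal{E}_G|.$$ -/

import Mathlib

namespace CellAut

/-- `τ : A^G → A^G` is a cellular automaton: there are a finite memory set `S ⊆ G` and a local
function `μ : A^S → A` such that `τ(x)(g) = μ(s ↦ x(s g))` for all `x` and `g`, that is, `μ` is
applied to the restriction to `S` of the configuration `h ↦ x(h g)`. -/
def IsCellularAutomaton {G A : Type*} [Group G] (τ : (G → A) → (G → A)) : Prop :=
  ∃ (S : Finset G) (μ : (S → A) → A), ∀ (x : G → A) (g : G), τ x g = μ (fun s => x (s.1 * g))

theorem isCellularAutomaton_id {G A : Type*} [Group G] :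
    IsCellularAutomaton (fun x : G → A => x) :=
  ⟨{1}, fun y => y ⟨1, Finset.mem_singleton_self 1⟩, fun x g => by simp⟩

theorem IsCellularAutomaton.comp {G A : Type*} [Group G] {τ σ : (G → A) → (G → A)}
    (hτ : IsCellularAutomaton τ) (hσ : IsCellularAutomaton σ) :
    IsCellularAutomaton (fun x => τ (σ x)) := by
  classical
  obtain ⟨S, μ, hμ⟩ := hτ
  obtain ⟨T, ν, hν⟩ := hσ
  refine ⟨Finset.image₂ (fun t s => t * s) T S,
    fun y => μ (fun s => ν (fun t => y ⟨t.1 * s.1, Finset.mem_image₂_of_mem t.2 s.2⟩)), ?_⟩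
  intro x g
  simp only [hμ, hν, mul_assoc]

/-- The monoid `CA(G;A)` of all cellular automata over `G` and `A`, as a submonoid of the full
transformation monoid of `A^G` (under composition). -/
def CA (G A : Type*) [Group G] : Submonoid (Function.End (G → A)) where
  carrier := {τ | IsCellularAutomaton (G := G) (A := A) τ}
  one_mem' := isCellularAutomaton_id
  mul_mem' := by
    intro τ σ hτ hσ
    exact IsCellularAutomaton.comp (τ := τ) (σ := σ) hτ hσ

/-- The invertible cellular automata `ICA(G;A)`: those with a two-sided inverse in `CA(G;A)`. -/
def ICA (G A : Type*) [Group G] : Set (CA G A) :=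
  {τ | ∃ φ : CA G A, τ * φ = 1 ∧ φ * τ = 1}

/-- The relative rank `Rank(M : U)`: the least cardinality of a set `V ⊆ M` such that `U ∪ V`
generates the monoid `M`. -/
noncomputable def relativeRank {M : Type*} [Monoid M] (U : Set M) : ℕ∞ :=
  ⨅ (V : Set M) (_ : Submonoid.closure (U ∪ V) = ⊤), V.encard

/-- The subgroup `g⁻¹ H g`. -/
def conjSubgroup {G : Type*} [Group G] (g : G) (H : Subgroup G) : Subgroup G :=
  H.map (MulAut.conj g⁻¹).toMonoidHom

theorem mem_conjSubgroup {G : Type*} [Group G] (g : G) (H : Subgroup G) (x : G) :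
    x ∈ conjSubgroup g H ↔ g * x * g⁻¹ ∈ H := by
  unfold conjSubgroup
  constructor
  · rintro ⟨y, hy, rfl⟩
    simpa [mul_assoc] using hy
  · intro hx
    exact ⟨_, hx, by simp [mul_assoc]⟩

theorem conjSubgroup_one {G : Type*} [Group G] (H : Subgroup G) : conjSubgroup 1 H = H := by
  ext x
  simp [mem_conjSubgroup]

theorem conjSubgroup_conjSubgroup {G : Type*} [Group G] (g h : G) (H : Subgroup G) :
    conjSubgroup h (conjSubgroup g H) = conjSubgroup (g * h) H := by
  ext x
  simp [mem_conjSubgroup, mul_assoc]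

theorem conjSubgroup_mono {G : Type*} [Group G] (g : G) {H K : Subgroup G} (h : H ≤ K) :
    conjSubgroup g H ≤ conjSubgroup g K :=
  Subgroup.map_mono h

/-- Conjugacy of subgroups of `G`. -/
def conjSetoid (G : Type*) [Group G] : Setoid (Subgroup G) where
  r H K := ∃ g : G, conjSubgroup g H = K
  iseqv :=
    { refl := fun H => ⟨1, conjSubgroup_one H⟩
      symm := by
        rintro H _ ⟨g, rfl⟩
        exact ⟨g⁻¹, by rw [conjSubgroup_conjSubgroup, mul_inv_cancel, conjSubgroup_one]⟩
      trans := by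
        rintro H _ _ ⟨g, rfl⟩ ⟨h, rfl⟩
        exact ⟨g * h, (conjSubgroup_conjSubgroup g h H).symm⟩ }

/-- The set `𝒞_G` of conjugacy classes of subgroups of `G`. -/
def SubgroupClass (G : Type*) [Group G] : Type _ := Quotient (conjSetoid G)

theorem exists_le_conjSubgroup {G : Type*} [Group G] {H K : Subgroup G} (a b : G)
    (h : ∃ g : G, H ≤ conjSubgroup g K) :
    ∃ g : G, conjSubgroup a H ≤ conjSubgroup g (conjSubgroup b K) := by
  obtain ⟨g, hg⟩ := h
  refine ⟨b⁻¹ * (g * a), ?_⟩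
  rw [conjSubgroup_conjSubgroup, mul_inv_cancel_left, ← conjSubgroup_conjSubgroup]
  exact conjSubgroup_mono a hg

/-- The relation `[H] ≤ [K]` on `𝒞_G`: `H ≤ g⁻¹ K g` for some `g ∈ G`. -/
def SubgroupClass.Le {G : Type*} [Group G] (c d : SubgroupClass G) : Prop :=
  Quotient.liftOn₂ c d (fun H K : Subgroup G => ∃ g : G, H ≤ conjSubgroup g K) (by
    intro H K H' K' hH hK
    obtain ⟨a, rfl⟩ := hH
    obtain ⟨b, rfl⟩ := hK
    refine propext ⟨exists_le_conjSubgroup a b, fun h => ?_⟩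
    have h' := exists_le_conjSubgroup a⁻¹ b⁻¹ h
    simpa only [conjSubgroup_conjSubgroup a a⁻¹, conjSubgroup_conjSubgroup b b⁻¹,
      mul_inv_cancel, conjSubgroup_one] using h')

/-- The edge set `ℰ_G = {([H],[K]) : [H] ≤ [K]}` (loops included) of the directed graph on the
conjugacy classes of subgroups of `G`. -/
def edgeSet (G : Type*) [Group G] : Set (SubgroupClass G × SubgroupClass G) :=
  {p | SubgroupClass.Le p.1 p.2}

end CellAut

/-! For finite `G`, cellular automata are exactly the maps of `A^G` commuting with the shift action,
and the invertible ones are the injective ones. An equivariant map can only enlarge stabilizers. An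
elementary collapsing sends one orbit onto another, along an inclusion of stabilizers `H ≤ K`, and
fixes all other points. As `G` is abelian, stabilizers are constant on orbits, so a collapsing is
determined by `(H, K)` up to conjugation by units (`exists_equivariant_map_pair`).

Upper bound: the units and one collapsing for each pair generate everything
(`mem_of_isEquivariant`). Lower bound: when a collapsing is written as a word in generators, the
rightmost non-unit letter must itself carry the pair `(H, K)` (`hasCollapseType_of_factor`), and a
map carries at most one pair (`HasCollapseType.unique`). The condition on `|A|` gives each subgroup
two orbits with that stabilizer (`exists_two_orbits`), so loops `H = K` occur as well. -/

namespace CellAut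

open MulAction

/-! ### Equivariant maps, elementary collapsings and their types -/

section EquivariantMaps

/-- Maps commuting with the action of `G`. -/
def IsEquivariant (G : Type*) {X : Type*} [SMul G X] (f : X → X) : Prop :=
  ∀ (g : G) (x : X), f (g • x) = g • f x

open Classical in
/-- The map sending `g • x` to `g • y` and agreeing with `f` off the orbit of `x`. -/
noncomputable def orbitUpdate (G : Type*) {X : Type*} [SMul G X] (f : X → X) (x y z : X) : X :=
  if h : ∃ g : G, g • x = z then h.choose • y else f z

theorem stabilizer_smul_of_comm {G X : Type*} [CommGroup G] [MulAction G X] (g : G) (x : X) :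
    stabilizer G (g • x) = stabilizer G x := by
  ext h
  rw [mem_stabilizer_iff, mem_stabilizer_iff, smul_comm, smul_left_cancel_iff]

theorem smul_eq_smul_of_stabilizer_le {G X : Type*} [Group G] [MulAction G X] {x y : X}
    (h : stabilizer G x ≤ stabilizer G y) {g k : G} (hgk : g • x = k • x) : g • y = k • y := by
  have h1 : k⁻¹ * g ∈ stabilizer G x := by
    rw [mem_stabilizer_iff, mul_smul, hgk, inv_smul_smul]
  have h2 := h h1
  rw [mem_stabilizer_iff, mul_smul, inv_smul_eq_iff] at h2
  exact h2

theorem orbitUpdate_smul {G X : Type*} [Group G] [MulAction G X] (f : X → X) {x y : X}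
    (h : stabilizer G x ≤ stabilizer G y) (g : G) : orbitUpdate G f x y (g • x) = g • y := by
  have hex : ∃ k : G, k • x = g • x := ⟨g, rfl⟩
  rw [orbitUpdate, dif_pos hex]
  exact smul_eq_smul_of_stabilizer_le h hex.choose_spec

theorem orbitUpdate_self {G X : Type*} [Group G] [MulAction G X] (f : X → X) {x y : X}
    (h : stabilizer G x ≤ stabilizer G y) : orbitUpdate G f x y x = y := by
  simpa using orbitUpdate_smul f h 1

theorem orbitUpdate_of_notMem {G X : Type*} [Group G] [MulAction G X] (f : X → X) {x y z : X}
    (hz : z ∉ orbit G x) : orbitUpdate G f x y z = f z :=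
  dif_neg hz

theorem smul_mem_orbit_iff' {G X : Type*} [Group G] [MulAction G X] {g : G} {x z : X} :
    g • z ∈ orbit G x ↔ z ∈ orbit G x := by
  rw [← orbit_eq_iff, ← orbit_eq_iff, orbit_smul]

theorem IsEquivariant.orbitUpdate {G X : Type*} [Group G] [MulAction G X] {f : X → X}
    (hf : IsEquivariant G f) {x y : X} (h : stabilizer G x ≤ stabilizer G y) :
    IsEquivariant G (orbitUpdate G f x y) := by
  intro g z
  by_cases hz : z ∈ orbit G x
  · obtain ⟨k, rfl⟩ := hz
    simp only [smul_smul, orbitUpdate_smul f h]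
  · rw [orbitUpdate_of_notMem f hz, orbitUpdate_of_notMem f (mt smul_mem_orbit_iff'.1 hz), hf]

theorem IsEquivariant.stabilizer_le {G X : Type*} [Group G] [MulAction G X] {f : X → X}
    (hf : IsEquivariant G f) (x : X) : stabilizer G x ≤ stabilizer G (f x) := by
  intro g hg
  rw [mem_stabilizer_iff] at hg ⊢
  rw [← hf, hg]

theorem IsEquivariant.stabilizer_eq {G X : Type*} [Group G] [MulAction G X] {f : X → X}
    (hf : IsEquivariant G f) (hinj : Function.Injective f) (x : X) :
    stabilizer G (f x) = stabilizer G x := by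
  refine le_antisymm (fun g hg => ?_) (hf.stabilizer_le x)
  rw [mem_stabilizer_iff, ← hf] at hg
  exact hinj hg

theorem IsEquivariant.id {G X : Type*} [SMul G X] : IsEquivariant G (fun x : X => x) :=
  fun _ _ => rfl

theorem IsEquivariant.comp {G X : Type*} [SMul G X] {f k : X → X}
    (hf : IsEquivariant G f) (hk : IsEquivariant G k) : IsEquivariant G (fun x => f (k x)) :=
  fun g x => by simp only [hk g x, hf g (k x)]

/-- Two points with the same stabilizer are exchanged by an equivariant bijection fixing all points
outside their orbits. -/
theorem exists_equivariant_swap {G X : Type*} [Group G] [MulAction G X] {a b : X}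
    (h : stabilizer G a = stabilizer G b) :
    ∃ u : X → X, IsEquivariant G u ∧ Function.Injective u ∧ u a = b ∧
      ∀ z, z ∉ orbit G a → z ∉ orbit G b → u z = z := by
  set v : X → X := orbitUpdate G (fun z => z) b a with hv
  have hb : ∀ g : G, v (g • b) = g • a := orbitUpdate_smul _ h.ge
  have hn : ∀ z, z ∉ orbit G b → v z = z := fun z hz => orbitUpdate_of_notMem _ hz
  have ha' : ∀ g : G, orbitUpdate G v a b (g • a) = g • b := orbitUpdate_smul _ h.le
  have hn' : ∀ z, z ∉ orbit G a → orbitUpdate G v a b z = v z :=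
    fun z hz => orbitUpdate_of_notMem _ hz
  refine ⟨orbitUpdate G v a b, (IsEquivariant.id.orbitUpdate h.ge).orbitUpdate h.le, ?_,
    orbitUpdate_self _ h.le, fun z hza hzb => (hn' z hza).trans (hn z hzb)⟩
  have key : ∀ z w, z ∈ orbit G a → orbitUpdate G v a b z = orbitUpdate G v a b w → z = w := by
    rintro _ w ⟨g, rfl⟩ hzw
    simp only at hzw ⊢
    rw [ha'] at hzw
    by_cases hw : w ∈ orbit G a
    · obtain ⟨k, rfl⟩ := hw
      simp only at hzw ⊢
      rw [ha'] at hzw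
      exact smul_eq_smul_of_stabilizer_le h.ge hzw
    · rw [hn' _ hw] at hzw
      by_cases hwb : w ∈ orbit G b
      · obtain ⟨k, rfl⟩ := hwb
        simp only [smul_mem_orbit_iff'] at hzw hw
        rw [hb] at hzw
        refine absurd ?_ hw
        rw [← smul_mem_orbit_iff' (g := g), hzw]
        exact mem_orbit _ _
      · rw [hn _ hwb] at hzw
        exact absurd (hzw ▸ mem_orbit _ _) hwb
  intro z w hzw
  by_cases hz : z ∈ orbit G a
  · exact key z w hz hzw
  by_cases hw : w ∈ orbit G a
  · exact (key w z hw hzw.symm).symm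
  rw [hn' _ hz, hn' _ hw] at hzw
  by_cases hzb : z ∈ orbit G b
  · obtain ⟨g, rfl⟩ := hzb
    simp only at hzw ⊢
    rw [hb] at hzw
    by_cases hwb : w ∈ orbit G b
    · obtain ⟨k, rfl⟩ := hwb
      simp only at hzw ⊢
      rw [hb] at hzw
      exact smul_eq_smul_of_stabilizer_le h.le hzw
    · rw [hn _ hwb] at hzw
      exact absurd (hzw ▸ mem_orbit _ _) hw
  · rw [hn _ hzb] at hzw
    by_cases hwb : w ∈ orbit G b
    · obtain ⟨k, rfl⟩ := hwb
      simp only at hzw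
      rw [hb] at hzw
      exact absurd (hzw ▸ mem_orbit _ _) hz
    · rwa [hn _ hwb] at hzw

/-- A pair of points in distinct orbits can be moved by an equivariant bijection to any other such
pair with the same stabilizers. -/
theorem exists_equivariant_map_pair {G X : Type*} [CommGroup G] [MulAction G X] {x y x' y' : X}
    (hx : stabilizer G x = stabilizer G x') (hy : stabilizer G y = stabilizer G y')
    (hxy : y ∉ orbit G x) (hxy' : y' ∉ orbit G x') :
    ∃ u : X → X, IsEquivariant G u ∧ Function.Injective u ∧ u x = x' ∧ u y = y' := by
  obtain ⟨u, hu, hui, hux, -⟩ := exists_equivariant_swap hx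
  obtain ⟨v, hv, hvi, hvy, hvn⟩ := exists_equivariant_swap ((hu.stabilizer_eq hui y).trans hy)
  refine ⟨fun z => v (u z), hv.comp hu, hvi.comp hui, ?_, hvy⟩
  simp only [hux]
  -- `v` carries `u y` to `y'` and must leave `x' = u x` alone: `x'` lies in neither orbit, because
  -- `u` is injective and equivariant and by `hxy'`.
  refine hvn _ (fun hmem => hxy ?_) (fun hmem => hxy' (mem_orbit_symm.1 hmem))
  obtain ⟨g, hg⟩ := hmem
  simp only at hg
  rw [← hu, ← hux] at hg
  rw [← mem_orbit_symm, ← hui hg]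
  exact mem_orbit _ _

/-- `f` is injective and preserves stabilizers on the points whose stabilizer is not `H`, it is not
injective, and the stabilizer `H` is turned into `K` only. -/
structure HasCollapseType (G : Type*) {X : Type*} [Group G] [MulAction G X] (f : X → X)
    (H K : Subgroup G) : Prop where
  stabilizer_eq : ∀ z, stabilizer G z ≠ H → stabilizer G (f z) = stabilizer G z
  injOn : Set.InjOn f {z | stabilizer G z ≠ H}
  not_injective : ¬ Function.Injective f
  exists_eq : H ≠ K → ∃ x, stabilizer G x = H ∧ stabilizer G (f x) = K
  eq_or_eq : ∀ z, stabilizer G z = H → stabilizer G (f z) = H ∨ stabilizer G (f z) = K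

theorem HasCollapseType.snd_eq {G X : Type*} [Group G] [MulAction G X] {f : X → X}
    {H K K' : Subgroup G} (h : HasCollapseType G f H K) (h' : HasCollapseType G f H K')
    (hK : H ≠ K) : K = K' := by
  obtain ⟨x, hx, hfx⟩ := h.exists_eq hK
  rcases h'.eq_or_eq x hx with h1 | h1
  · exact absurd (h1.symm.trans hfx) hK
  · exact hfx.symm.trans h1

/-- If `H ≠ H'`, then `f` preserves every stabilizer, so two points with the same image share a
stabilizer; it differs from `H` or from `H'`, which makes `f` injective. -/
theorem HasCollapseType.unique {G X : Type*} [Group G] [MulAction G X] {f : X → X}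
    {H K H' K' : Subgroup G} (h : HasCollapseType G f H K) (h' : HasCollapseType G f H' K') :
    H = H' ∧ K = K' := by
  have hH : H = H' := by
    by_contra hne
    refine h.not_injective fun a b hab => ?_
    have hs : ∀ z, stabilizer G (f z) = stabilizer G z := by
      intro z
      by_cases hz : stabilizer G z = H
      · exact h'.stabilizer_eq z (hz ▸ hne)
      · exact h.stabilizer_eq z hz
    have hst : stabilizer G a = stabilizer G b := by rw [← hs a, hab, hs]
    by_cases ha : stabilizer G a = H
    · exact h'.injOn (ha ▸ hne : stabilizer G a ≠ H') (hst ▸ ha ▸ hne : stabilizer G b ≠ H') hab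
    · exact h.injOn ha (hst ▸ ha : stabilizer G b ≠ H) hab
  subst hH
  refine ⟨rfl, ?_⟩
  by_cases hK : H = K
  · by_cases hK' : H = K'
    · exact hK.symm.trans hK'
    · exact (h'.snd_eq h hK').symm
  · exact h.snd_eq h' hK

/-- An equivariant bijection permutes the points with a given stabilizer, so it can be cancelled on
the right. -/
theorem HasCollapseType.of_comp {G X : Type*} [Group G] [Finite X] [MulAction G X] {f u : X → X}
    {H K : Subgroup G} (hu : IsEquivariant G u) (hui : Function.Injective u)
    (h : HasCollapseType G (fun x => f (u x)) H K) : HasCollapseType G f H K := by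
  have hsurj : Function.Surjective u := Finite.surjective_of_injective hui
  have hs := hu.stabilizer_eq hui
  refine ⟨fun z hz => ?_, fun a ha b hb hab => ?_, fun hf => h.not_injective (hf.comp hui),
    fun hK => ?_, fun z hz => ?_⟩
  · obtain ⟨z, rfl⟩ := hsurj z
    rw [hs] at hz ⊢
    exact h.stabilizer_eq z hz
  · obtain ⟨a, rfl⟩ := hsurj a
    obtain ⟨b, rfl⟩ := hsurj b
    simp only [Set.mem_ofPred_eq, hs] at ha hb
    rw [h.injOn ha hb hab]
  · obtain ⟨x, hx, hfx⟩ := h.exists_eq hK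
    exact ⟨u x, (hs x).trans hx, hfx⟩
  · obtain ⟨z, rfl⟩ := hsurj z
    rw [hs] at hz
    exact h.eq_or_eq z hz

/-- An equivariant non-injective right factor of an elementary collapsing has the same type. -/
theorem hasCollapseType_of_factor {G X : Type*} [CommGroup G] [Finite X] [MulAction G X]
    {x y : X} (hxy : stabilizer G x ≤ stabilizer G y) {s t : X → X}
    (ht : IsEquivariant G t) (hti : ¬ Function.Injective t)
    (hst : ∀ z, orbitUpdate G (fun z => z) x y z = s (t z)) :
    HasCollapseType G t (stabilizer G x) (stabilizer G y) := by
  have hker : ∀ a b, t a = t b →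
      orbitUpdate G (fun z => z) x y a = orbitUpdate G (fun z => z) x y b := by
    intro a b hab
    rw [hst, hst, hab]
  have hex : orbitUpdate G (fun z => z) x y x = y := orbitUpdate_self _ hxy
  have hn : ∀ z, z ∉ orbit G x → orbitUpdate G (fun z => z) x y z = z :=
    fun z hz => orbitUpdate_of_notMem _ hz
  have hinj : ∀ a b, a ∉ orbit G x → b ∉ orbit G x → t a = t b → a = b := by
    intro a b ha hb hab
    rw [← hn a ha, ← hn b hb, hker a b hab]
  have hstab : ∀ z, z ∉ orbit G x → stabilizer G (t z) = stabilizer G z := by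
    intro z hz
    refine le_antisymm (fun g hg => ?_) (ht.stabilizer_le z)
    rw [mem_stabilizer_iff, ← ht] at hg
    exact hinj _ _ (mt smul_mem_orbit_iff'.1 hz) hz hg
  have hne : ∀ z, stabilizer G z ≠ stabilizer G x → z ∉ orbit G x := by
    rintro _ hz ⟨g, rfl⟩
    exact hz (stabilizer_smul_of_comm g x)
  -- `t` is injective off the orbit of `x`, so some collision meets that orbit, and equivariance
  -- translates it to `x`.
  have hcoll : ∃ b, b ≠ x ∧ t x = t b := by
    have aux : ∀ a b, a ∈ orbit G x → a ≠ b → t a = t b → ∃ b, b ≠ x ∧ t x = t b := by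
      rintro _ b ⟨g, rfl⟩ hab htab
      simp only at hab htab
      refine ⟨g⁻¹ • b, fun hb => hab ?_, ?_⟩
      · rw [← hb, smul_inv_smul]
      · rw [ht, ← htab, ht, inv_smul_smul]
    simp only [Function.Injective, not_forall] at hti
    obtain ⟨a, b, htab, hab⟩ := hti
    by_cases ha : a ∈ orbit G x
    · exact aux a b ha hab htab
    by_cases hb : b ∈ orbit G x
    · exact aux b a hb (Ne.symm hab) htab.symm
    exact absurd (hinj a b ha hb htab) hab
  have hkey : ∀ c, c ∉ orbit G x → t x = t c → stabilizer G (t x) = stabilizer G y := by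
    intro c hc htc
    have hcy := hker _ _ htc
    rw [hex, hn c hc] at hcy
    rw [htc, hcy, hstab c hc]
  have hK : stabilizer G (t x) = stabilizer G y := by
    obtain ⟨b, hbx, htb⟩ := hcoll
    by_cases hb : b ∈ orbit G x
    · obtain ⟨h, rfl⟩ := hb
      simp only at hbx htb
      -- A collision inside the orbit strictly enlarges the stabilizer. Then `t` permutes the
      -- finitely many points with the new stabilizer, so `t x = t c` for some `c` off the orbit,
      -- and the other case applies.
      have hL : stabilizer G (t x) ≠ stabilizer G x := by
        intro hL
        apply hbx
        rw [← mem_stabilizer_iff, ← hL, mem_stabilizer_iff, ← ht, ← htb]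
      have hmaps : Set.MapsTo t {z | stabilizer G z = stabilizer G (t x)}
          {z | stabilizer G z = stabilizer G (t x)} := by
        intro z (hz : stabilizer G z = _)
        exact (hstab z (hne z (hz ▸ hL))).trans hz
      have hinjOn : Set.InjOn t {z | stabilizer G z = stabilizer G (t x)} := by
        intro a (ha : stabilizer G a = _) b (hb : stabilizer G b = _) hab
        exact hinj a b (hne a (ha ▸ hL)) (hne b (hb ▸ hL)) hab
      obtain ⟨c, hc, htc⟩ := (((Set.toFinite _).injOn_iff_bijOn_of_mapsTo hmaps).1 hinjOn).surjOn
        (rfl : stabilizer G (t x) = stabilizer G (t x))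
      exact hkey c (hne c ((hc : stabilizer G c = _) ▸ hL)) htc.symm
    · exact hkey b hb htb
  refine ⟨fun z hz => hstab z (hne z hz), fun a ha b hb => hinj a b (hne a ha) (hne b hb), hti,
    fun _ => ⟨x, rfl, hK⟩, fun z hz => ?_⟩
  by_cases hzx : z ∈ orbit G x
  · obtain ⟨g, rfl⟩ := hzx
    right
    simp only
    rw [ht, stabilizer_smul_of_comm, hK]
  · exact Or.inl ((hstab z hzx).trans hz)

/-- A family of equivariant maps closed under composition that contains the bijections and all
elementary collapsings contains every equivariant map moving only points with stabilizer `L`. -/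
theorem mem_of_fixes_off_stabilizer {G X : Type*} [CommGroup G] [Finite X] [MulAction G X]
    {P : (X → X) → Prop} (hcomp : ∀ f k, P f → P k → P (fun x => f (k x)))
    (hbij : ∀ f, IsEquivariant G f → Function.Injective f → P f)
    (hcoll : ∀ x y : X, stabilizer G x ≤ stabilizer G y → y ∉ orbit G x →
      P (orbitUpdate G (fun z => z) x y))
    (L : Subgroup G) (f : X → X) (hf : IsEquivariant G f)
    (hfix : ∀ z, stabilizer G z ≠ L → f z = z) : P f := by
  -- Induction on the number of missed points: collapse `x` onto some `y` with the same image, then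
  -- apply `f` with the orbit of `x` redirected to a missed point `w`.
  induction hn : (Set.range f)ᶜ.ncard using Nat.strong_induction_on generalizing f with
  | _ n ih =>
    by_cases hfi : Function.Injective f
    · exact hbij f hf hfi
    obtain ⟨w, hw⟩ : ∃ w, w ∉ Set.range f := by
      by_contra! hall
      exact hfi (Finite.injective_iff_surjective.2 hall)
    have hwL : stabilizer G w = L := by
      by_contra hwL
      exact hw ⟨w, hfix w hwL⟩
    obtain ⟨x, y, hxL, hyx, hfxy, hle⟩ : ∃ x y, stabilizer G x = L ∧ y ∉ orbit G x ∧ f x = f y ∧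
        stabilizer G x ≤ stabilizer G y := by
      by_cases hall : ∀ x, stabilizer G x = L → stabilizer G (f x) = L
      · simp only [Function.Injective, not_forall] at hfi
        obtain ⟨a, b, hfab, hab⟩ := hfi
        have hs : ∀ z, stabilizer G (f z) = stabilizer G z := by
          intro z
          by_cases hz : stabilizer G z = L
          · rw [hall z hz, hz]
          · rw [hfix z hz]
        have hst : stabilizer G a = stabilizer G b := by rw [← hs a, hfab, hs]
        refine ⟨a, b, ?_, ?_, hfab, hst.le⟩
        · by_contra haL
          apply hab
          rw [← hfix a haL, hfab, hfix b (hst ▸ haL)]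
        · rintro ⟨g, rfl⟩
          apply hab
          simp only at hfab ⊢
          rw [hf, eq_comm, ← mem_stabilizer_iff, hs] at hfab
          exact (mem_stabilizer_iff.1 hfab).symm
      · push Not at hall
        obtain ⟨x, hx, hfx⟩ := hall
        -- If the stabilizer of `x` grows, then `f x` is fixed by `f` and collides with `x`.
        refine ⟨x, f x, hx, ?_, (hfix _ hfx).symm, hf.stabilizer_le x⟩
        rintro ⟨g, hg⟩
        simp only at hg
        rw [← hg, stabilizer_smul_of_comm] at hfx
        exact hfx hx
    have hxw : stabilizer G x ≤ stabilizer G w := (hxL.trans hwL.symm).le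
    have hsub : Set.range f ⊆ Set.range (orbitUpdate G f x w) := by
      rintro _ ⟨z, rfl⟩
      by_cases hz : z ∈ orbit G x
      · obtain ⟨g, rfl⟩ := hz
        -- Redirecting the orbit of `x` loses no value, since `y` still attains them.
        refine ⟨g • y, ?_⟩
        rw [orbitUpdate_of_notMem f (mt smul_mem_orbit_iff'.1 hyx)]
        simp only [hf g, hfxy]
      · exact ⟨z, orbitUpdate_of_notMem f hz⟩
    have hlt : (Set.range (orbitUpdate G f x w))ᶜ.ncard < n := by
      rw [← hn]
      refine Set.ncard_lt_ncard ?_ (Set.toFinite _)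
      refine compl_lt_compl_iff_lt.2 (hsub.ssubset_of_ne fun heq => hw ?_)
      rw [heq]
      exact ⟨x, orbitUpdate_self f hxw⟩
    have hP := ih _ hlt (orbitUpdate G f x w) (hf.orbitUpdate hxw) (fun z hz => by
      rw [orbitUpdate_of_notMem f, hfix z hz]
      rintro ⟨g, rfl⟩
      exact hz ((stabilizer_smul_of_comm g x).trans hxL)) rfl
    have hdecomp : f = fun z => orbitUpdate G f x w (orbitUpdate G (fun z => z) x y z) := by
      funext z
      by_cases hz : z ∈ orbit G x
      · obtain ⟨g, rfl⟩ := hz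
        simp only
        rw [orbitUpdate_smul _ hle, orbitUpdate_of_notMem f (mt smul_mem_orbit_iff'.1 hyx), hf, hf,
          hfxy]
      · rw [orbitUpdate_of_notMem _ hz, orbitUpdate_of_notMem _ hz]
    rw [hdecomp]
    exact hcomp _ _ hP (hcoll x y hle hyx)

/-- A family of equivariant maps closed under composition that contains the bijections and all
elementary collapsings contains every equivariant map. -/
theorem mem_of_isEquivariant {G X : Type*} [CommGroup G] [Finite G] [Finite X] [MulAction G X]
    {P : (X → X) → Prop} (hcomp : ∀ f k, P f → P k → P (fun x => f (k x)))
    (hbij : ∀ f, IsEquivariant G f → Function.Injective f → P f)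
    (hcoll : ∀ x y : X, stabilizer G x ≤ stabilizer G y → y ∉ orbit G x →
      P (orbitUpdate G (fun z => z) x y))
    (f : X → X) (hf : IsEquivariant G f) : P f := by
  classical
  induction hn : {z | f z ≠ z}.ncard using Nat.strong_induction_on generalizing f with
  | _ n ih =>
    by_cases hid : ∀ z, f z = z
    · exact hbij f hf fun a b hab => by rwa [hid, hid] at hab
    push Not at hid
    obtain ⟨z₀, hz₀⟩ := hid
    -- Among stabilizers of moved points take a maximal `L`, and let `f` act first on the points
    -- with stabilizer `L`. If `f` sends such a point to one with a larger stabilizer, maximality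
    -- makes the image fixed, so the second factor leaves it there.
    obtain ⟨L, ⟨z₁, hz₁, hz₁L⟩, hmax⟩ :=
      (Set.toFinite {L : Subgroup G | ∃ z, f z ≠ z ∧ stabilizer G z = L}).exists_maximal
        ⟨_, z₀, hz₀, rfl⟩
    have hbox : ∀ (p q : X → X), IsEquivariant G p → IsEquivariant G q →
        IsEquivariant G (fun z => if stabilizer G z = L then p z else q z) := by
      intro p q hp hq g z
      simp only [stabilizer_smul_of_comm]
      split_ifs
      · exact hp g z
      · exact hq g z
    have hP₁ : P (fun z => if stabilizer G z = L then f z else z) :=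
      mem_of_fixes_off_stabilizer hcomp hbij hcoll L _ (hbox _ _ hf IsEquivariant.id)
        fun z hz => if_neg hz
    have hlt : {z | (if stabilizer G z = L then z else f z) ≠ z}.ncard < n := by
      rw [← hn]
      refine Set.ncard_lt_ncard ?_ (Set.toFinite _)
      refine Set.ssubset_iff_subset_ne.2 ⟨fun z hz => ?_, fun heq => ?_⟩
      · simp only [Set.mem_ofPred_eq] at hz ⊢
        split_ifs at hz with h
        · exact absurd rfl hz
        · exact hz
      · have : z₁ ∈ {z | f z ≠ z} := hz₁
        rw [← heq] at this
        simp [hz₁L] at this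
    have hP₂ := ih _ hlt _ (hbox _ _ IsEquivariant.id hf) rfl
    have hdecomp : f = fun z => (fun z => if stabilizer G z = L then z else f z)
        ((fun z => if stabilizer G z = L then f z else z) z) := by
      funext z
      by_cases hz : stabilizer G z = L
      · simp only [if_pos hz]
        split_ifs with h
        · rfl
        · by_contra hne
          have hle : L ≤ stabilizer G (f z) := hz ▸ hf.stabilizer_le z
          exact h (le_antisymm (hmax ⟨f z, Ne.symm hne, rfl⟩ hle) hle)
      · simp only [if_neg hz]
    rw [hdecomp]
    exact hcomp _ _ hP₂ hP₁

end EquivariantMaps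

/-! ### Relative rank of the monoid of equivariant maps -/

section RelativeRank

/-- `t` is the rightmost letter outside `U`. For maps, it is the first non-invertible one to act, so
the kernel of `t * u` lies in that of `m`. -/
theorem exists_factor_of_closure_eq_top {M : Type*} [Monoid M] {U V : Set M} (h1 : (1 : M) ∈ U)
    (hmul : ∀ a b, a ∈ U → b ∈ U → a * b ∈ U) (hV : Submonoid.closure (U ∪ V) = ⊤) (m : M)
    (hm : m ∉ U) : ∃ s t u : M, u ∈ U ∧ t ∈ V ∧ t ∉ U ∧ m = s * t * u := by
  have hmem : m ∈ Submonoid.closure (U ∪ V) := hV ▸ Submonoid.mem_top m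
  have key : m ∈ U ∨ ∃ s t u : M, u ∈ U ∧ t ∈ V ∧ t ∉ U ∧ m = s * t * u := by
    clear hm
    induction hmem using Submonoid.closure_induction with
    | mem x hx =>
      by_cases hxU : x ∈ U
      · exact Or.inl hxU
      · exact Or.inr ⟨1, x, 1, h1, hx.resolve_left hxU, hxU, by simp⟩
    | one => exact Or.inl h1
    | mul x y _ _ hx hy =>
      rcases hy with hy | ⟨s, t, u, hu, ht, htU, rfl⟩
      · rcases hx with hx | ⟨s, t, u, hu, ht, htU, rfl⟩
        · exact Or.inl (hmul x y hx hy)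
        · exact Or.inr ⟨s, t, u * y, hmul u y hu hy, ht, htU, by simp only [mul_assoc]⟩
      · exact Or.inr ⟨x * s, t, u, hu, ht, htU, by simp only [mul_assoc]⟩
  exact key.resolve_left hm

/-- The monoid of equivariant maps of a finite `G`-set, `G` finite abelian, in which each subgroup is
the stabilizer of points in two distinct orbits has relative rank modulo its units the number of
pairs of nested subgroups. -/
theorem relativeRank_equivariant {G X : Type*} [CommGroup G] [Finite G] [Finite X] [MulAction G X]
    (M : Submonoid (Function.End X)) (hM : ∀ f : Function.End X, f ∈ M ↔ IsEquivariant G f)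
    (U : Set M) (hU : ∀ f : M, f ∈ U ↔ Function.Injective (f : Function.End X))
    (htwo : ∀ H : Subgroup G, ∃ x y : X, stabilizer G x = H ∧ stabilizer G y = H ∧
      y ∉ orbit G x) :
    relativeRank U = {p : Subgroup G × Subgroup G | p.1 ≤ p.2}.encard := by
  classical
  have hpair : ∀ p : Subgroup G × Subgroup G, ∃ x y : X, stabilizer G x = p.1 ∧
      stabilizer G y = p.2 ∧ y ∉ orbit G x := by
    rintro ⟨H, K⟩
    obtain ⟨x, y, hx, hy, hxy⟩ := htwo H
    by_cases hHK : H = K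
    · exact ⟨x, y, hx, hHK ▸ hy, hxy⟩
    · obtain ⟨y', -, hy', -⟩ := htwo K
      refine ⟨x, y', hx, hy', ?_⟩
      rintro ⟨g, rfl⟩
      exact hHK (hx.symm.trans ((stabilizer_smul_of_comm g x).symm.trans hy'))
  choose a b ha hb hab using hpair
  have hale : ∀ p : Subgroup G × Subgroup G, p.1 ≤ p.2 →
      stabilizer G (a p) ≤ stabilizer G (b p) := fun p hp => by rwa [ha, hb]
  have hmemM : ∀ {x y : X}, stabilizer G x ≤ stabilizer G y →
      (orbitUpdate G (fun z => z) x y : Function.End X) ∈ M := fun h =>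
    (hM _).2 (IsEquivariant.id.orbitUpdate h)
  have hnotU : ∀ {x y : X} (h : stabilizer G x ≤ stabilizer G y), y ∉ orbit G x →
      (⟨orbitUpdate G (fun z => z) x y, hmemM h⟩ : M) ∉ U := by
    intro x y h hy hmem
    have hinj := (hU _).1 hmem
    refine hy ?_
    have : y = x := hinj (by
      simp only
      rw [orbitUpdate_of_notMem _ hy, orbitUpdate_self _ h])
    rw [this]
    exact mem_orbit_self x
  let e : Subgroup G × Subgroup G → M := fun p =>
    if h : p.1 ≤ p.2 then ⟨orbitUpdate G (fun z => z) (a p) (b p), hmemM (hale p h)⟩ else 1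
  apply le_antisymm
  · refine (iInf₂_le (e '' {p | p.1 ≤ p.2}) ?_).trans (Set.encard_image_le _ _)
    set N := Submonoid.closure (U ∪ e '' {p | p.1 ≤ p.2}) with hN
    have hUN : ∀ (f : Function.End X) (hf : IsEquivariant G f), Function.Injective f →
        (⟨f, (hM f).2 hf⟩ : M) ∈ N := fun f hf hfi =>
      Submonoid.subset_closure (Or.inl ((hU _).2 hfi))
    refine eq_top_iff.2 fun m _ => ?_
    obtain ⟨hm, hmN⟩ : ∃ h : (m : Function.End X) ∈ M, (⟨m, h⟩ : M) ∈ N := by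
      refine mem_of_isEquivariant (G := G)
        (P := fun f => ∃ h : (f : Function.End X) ∈ M, (⟨f, h⟩ : M) ∈ N) ?_ ?_ ?_ _
        ((hM _).1 m.2)
      · rintro f k ⟨hf, hfN⟩ ⟨hk, hkN⟩
        exact ⟨M.mul_mem hf hk, N.mul_mem hfN hkN⟩
      · exact fun f hf hfi => ⟨(hM f).2 hf, hUN f hf hfi⟩
      · intro x y hxy hy
        refine ⟨hmemM hxy, ?_⟩
        set p : Subgroup G × Subgroup G := (stabilizer G x, stabilizer G y)
        have hp : p.1 ≤ p.2 := hxy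
        -- Conjugating by `u` turns the chosen collapsing for `p` into the one from `x` to `y`.
        obtain ⟨u, hu, hui, hux, huy⟩ := exists_equivariant_map_pair (ha p).symm (hb p).symm hy
          (hab p)
        obtain ⟨v, hvu, huv⟩ := Function.bijective_iff_has_inverse.1
          ⟨hui, Finite.surjective_of_injective hui⟩
        have hv : IsEquivariant G v := fun g z => hui (by rw [hu, huv, huv])
        have heN : (⟨orbitUpdate G (fun z => z) (a p) (b p), hmemM (hale p hp)⟩ : M) ∈ N := by
          have : e p ∈ N := Submonoid.subset_closure (Or.inr ⟨p, hp, rfl⟩)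
          simpa only [e, dif_pos hp] using this
        have hprod := N.mul_mem (N.mul_mem (hUN v hv huv.injective) heN) (hUN u hu hui)
        convert hprod using 1
        refine Subtype.ext (funext fun z => ?_)
        change orbitUpdate G (fun z => z) x y z
          = v (orbitUpdate G (fun z => z) (a p) (b p) (u z))
        by_cases hz : z ∈ orbit G x
        · obtain ⟨g, rfl⟩ := hz
          simp only
          rw [orbitUpdate_smul _ hxy, hu, hux, orbitUpdate_smul _ (hale p hp), ← huy, ← hu, hvu]
        · rw [orbitUpdate_of_notMem _ hz, orbitUpdate_of_notMem, hvu]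
          rintro ⟨g, hg⟩
          simp only at hg
          rw [← hux, ← hu] at hg
          exact hz ⟨g, hui hg⟩
    exact hmN
  · refine le_iInf₂ fun V hV => ?_
    have hex : ∀ p : Subgroup G × Subgroup G, p.1 ≤ p.2 → ∃ t ∈ V,
        HasCollapseType G (t : Function.End X) p.1 p.2 := by
      intro p hp
      obtain ⟨s, t, u, hu, htV, htU, hstu⟩ := exists_factor_of_closure_eq_top
        ((hU 1).2 Function.injective_id)
        (fun f k hf hk => (hU _).2 (((hU f).1 hf).comp ((hU k).1 hk))) hV _
        (hnotU (hale p hp) (hab p))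
      refine ⟨t, htV, HasCollapseType.of_comp ((hM _).1 u.2) ((hU u).1 hu) ?_⟩
      have hfac : ∀ z, orbitUpdate G (fun z => z) (a p) (b p) z
          = (s : Function.End X) ((t : Function.End X) ((u : Function.End X) z)) := fun z =>
        congrFun (congrArg Subtype.val hstu) z
      have h := hasCollapseType_of_factor (hale p hp)
        (((hM _).1 t.2).comp ((hM _).1 u.2)) (fun hinj => ?_) hfac
      · rwa [ha, hb] at h
      · refine htU ((hU t).2 ?_)
        exact (Function.Injective.of_comp_iff' _ (Finite.injective_iff_bijective.1 ((hU u).1 hu))).1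
          hinj
    choose! t htV ht using hex
    refine Set.encard_le_encard_of_injOn (f := t) (fun p hp => htV p hp) fun p hp q hq hpq => ?_
    obtain ⟨h1, h2⟩ := (ht p hp).unique (hpq ▸ ht q hq)
    exact Prod.ext h1 h2

end RelativeRank

/-! ### The shift action on configurations -/

section Shift

/-- The shift action of a commutative group `G` on `A^G`: `(g • x)(h) = x(h g)`. -/
abbrev shiftAction (G A : Type*) [Group G] : MulAction G (G → A) where
  smul g x := fun h => x (h * g)
  one_smul x := funext fun h => congrArg x (mul_one h)
  mul_smul g k x := funext fun h => congrArg x (mul_assoc h g k).symm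

theorem mem_CA_iff_isEquivariant {G A : Type*} [Group G] [Finite G] (f : Function.End (G → A)) :
    f ∈ CA G A ↔ letI := shiftAction G A; IsEquivariant G f := by
  let _ := shiftAction G A
  constructor
  · rintro ⟨S, μ, hμ⟩ g x
    funext h
    change f _ h = f x (h * g)
    rw [hμ, hμ]
    exact congrArg μ (funext fun s => congrArg x (mul_assoc s.1 h g))
  · intro hf
    have := Fintype.ofFinite G
    -- With all of `G` as memory set, the local rule is evaluation of `f` at the identity;
    -- equivariance gives the other coordinates.
    refine ⟨Finset.univ, fun y => f (fun h => y ⟨h, Finset.mem_univ h⟩) 1, fun x g => ?_⟩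
    have h : f (g • x) 1 = f x (1 * g) := congrFun (hf g x) 1
    rw [one_mul] at h
    exact h.symm

theorem mem_ICA_iff_injective {G A : Type*} [Group G] [Finite G] [Finite A] (f : CA G A) :
    f ∈ ICA G A ↔ Function.Injective (f : Function.End (G → A)) := by
  let _ := shiftAction G A
  constructor
  · rintro ⟨k, -, hk⟩
    exact Function.LeftInverse.injective (g := (k : Function.End (G → A)))
      fun x => congrFun (congrArg Subtype.val hk) x
  · intro hf
    obtain ⟨v, hvf, hfv⟩ := Function.bijective_iff_has_inverse.1
      (Finite.injective_iff_bijective.1 hf)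
    have hv : IsEquivariant G v := fun g z => hf (by
      rw [(mem_CA_iff_isEquivariant _).1 f.2, hfv, hfv])
    exact ⟨⟨v, (mem_CA_iff_isEquivariant v).2 hv⟩, Subtype.ext (funext hfv),
      Subtype.ext (funext hvf)⟩

open Classical in
theorem stabilizer_shiftAction_ite {G A : Type*} [Group G] (H : Subgroup G) {a b : A}
    (hab : a ≠ b) :
    letI := shiftAction G A
    stabilizer G (fun h : G => if h ∈ H then a else b) = H := by
  let _ := shiftAction G A
  ext g
  rw [mem_stabilizer_iff]
  constructor
  · intro hg
    have h1 : (if 1 * g ∈ H then a else b) = if (1 : G) ∈ H then a else b := congrFun hg 1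
    rw [one_mul, if_pos H.one_mem] at h1
    by_contra hgH
    rw [if_neg hgH] at h1
    exact hab h1.symm
  · intro hg
    funext h
    change (if h * g ∈ H then a else b) = _
    rw [Subgroup.mul_mem_cancel_right H hg]

/-- If `|A|` does not divide `|G|`, every subgroup is the stabilizer of configurations in two
distinct orbits. -/
theorem exists_two_orbits {G A : Type*} [Group G] [Finite A]
    (hq : 2 ≤ Nat.card A) (hdvd : ¬ Nat.card A ∣ Nat.card G) (H : Subgroup G) :
    letI := shiftAction G A
    ∃ x y : G → A, stabilizer G x = H ∧ stabilizer G y = H ∧ y ∉ orbit G x := by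
  classical
  let _ := shiftAction G A
  have := Fintype.ofFinite A
  rw [Nat.card_eq_fintype_card] at hq hdvd
  rcases hq.eq_or_lt with h2 | h3
  · obtain ⟨a, b, hab⟩ := Fintype.one_lt_card_iff.1 (lt_of_lt_of_le one_lt_two hq)
    refine ⟨_, _, stabilizer_shiftAction_ite H hab, stabilizer_shiftAction_ite H hab.symm, ?_⟩
    rintro ⟨g, hg⟩
    refine hdvd (h2 ▸ ?_)
    have hidx : H.index = 2 := by
      refine Subgroup.index_eq_two_iff.2 ⟨g, fun h => ?_⟩
      have hh : (if h * g ∈ H then a else b) = if h ∈ H then b else a := congrFun hg h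
      by_cases h1 : h * g ∈ H <;> by_cases h2 : h ∈ H <;> simp_all
    exact hidx ▸ H.index_dvd_card
  -- With a third symbol, the two configurations take different sets of values, so no shift relates
  -- them.
  · obtain ⟨a, b, c, hab, hac, hbc⟩ := Fintype.two_lt_card_iff.1 h3
    refine ⟨_, _, stabilizer_shiftAction_ite H hab, stabilizer_shiftAction_ite H hbc.symm, ?_⟩
    rintro ⟨g, hg⟩
    have hh : (if 1 * g ∈ H then a else b) = if (1 : G) ∈ H then c else b := congrFun hg 1
    rw [if_pos H.one_mem] at hh
    split_ifs at hh
    · exact hac hh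
    · exact hbc hh

end Shift

/-! ### Conjugacy classes of subgroups in the abelian case -/

section Edges

theorem conjSubgroup_of_comm {G : Type*} [CommGroup G] (g : G) (H : Subgroup G) :
    conjSubgroup g H = H := by
  ext x
  rw [mem_conjSubgroup, mul_inv_cancel_comm]

theorem encard_edgeSet_of_comm (G : Type*) [CommGroup G] :
    (edgeSet G).encard = {p : Subgroup G × Subgroup G | p.1 ≤ p.2}.encard := by
  have hinj : Function.Injective (Quotient.mk (conjSetoid G)) := by
    intro H K h
    obtain ⟨g, hg⟩ := Quotient.exact h
    rwa [conjSubgroup_of_comm] at hg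
  have himg : edgeSet G = Prod.map (Quotient.mk (conjSetoid G)) (Quotient.mk (conjSetoid G)) ''
      {p : Subgroup G × Subgroup G | p.1 ≤ p.2} := by
    ext ⟨c, d⟩
    constructor
    · induction c using Quotient.inductionOn with
      | _ H =>
      induction d using Quotient.inductionOn with
      | _ K =>
      rintro ⟨g, hg⟩
      rw [conjSubgroup_of_comm] at hg
      exact ⟨(H, K), hg, rfl⟩
    · rintro ⟨⟨H, K⟩, hHK, heq⟩
      obtain ⟨rfl, rfl⟩ := Prod.mk.inj heq
      exact ⟨1, by rw [conjSubgroup_one]; exact hHK⟩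
  rw [himg]
  exact (hinj.prodMap hinj).encard_image _

end Edges

end CellAut

theorem mainTheorem6 {G A : Type*} [CommGroup G] [Finite G] [Finite A]
    (hq : 2 ≤ Nat.card A) (hdvd : ¬ Nat.card A ∣ Nat.card G) :
    CellAut.relativeRank (CellAut.ICA G A) = (CellAut.edgeSet G).encard := by
  let _ := CellAut.shiftAction G A
  rw [CellAut.encard_edgeSet_of_comm]
  exact CellAut.relativeRank_equivariant (CellAut.CA G A) CellAut.mem_CA_iff_isEquivariant
    (CellAut.ICA G A) CellAut.mem_ICA_iff_injective (CellAut.exists_two_orbits hq hdvd)
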